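/- Let $S$ be a (commutative, Noetherian) regular ring, i.e. a Noetherian ring all of whose localizations at prime ideals are regular local rings; for instance, a regular domain. Let $M$ be a nonzero finitely generated $S$-module, let $e=\operatorname{pd}_S M$ be its projective dimension (a natural number), and let $I=\operatorname{ann}_S\operatorname{Ext}^e_S(M,S)$. Then $M$ has an associated prime $P$ of codimension (height) $e$ if and only if $H^0_I(M)\neq 0$, where $H^0_I(M)=\varinjlim_n\operatorname{Hom}_S(S/I^n,M)=\{m\in M : I^nm=0\text{ for some }n\}$ is the $0$-th local cohomology module of $M$ with support in $I$. -/

import Mathlib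

universe u

open CategoryTheory

/-- The associated primes of the `S`-module `M` whose codimension (height) equals `e`. -/
def associatedPrimesOfCodim (S : Type u) [CommRing S] (M : Type u) [AddCommGroup M] [Module S M]
    (e : ℕ) : Set (Ideal S) :=
  {P | P ∈ associatedPrimes S M ∧ P.height = e}

/-! ### Regular local rings: domain property, regular sequences, projective dimension. -/

section RegularLocalRing

open IsLocalRing

/-! `H^0_I(M)` is nonzero exactly when some associated prime `P` of `M` contains `I`, so it suffices
to show that for such `P`, `I ≤ P` iff `P` has height `e`. Since `P` is associated, `M_P` has depth
zero over the regular local ring `S_P`, hence `pd M_P = dim S_P = height P`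
(`projectiveDimension_eq_ringKrullDim`). This case of Auslander–Buchsbaum is proved directly: every
finite module has projective dimension at most `dim`, the residue field attains it by a regular
sequence, and the residue field embeds in `M_P`. On the other hand `I ≤ P` means that no element
outside `P` kills `Ext^e(M, S)`, which amounts to `pd M_P ≥ e` (`exists_annihilator_ext_iff`). As
`pd M_P ≤ pd M = e`, this is the equality `height P = e`. -/

lemma isLocalRing_quotient_span_singleton {R : Type*} [CommRing R] [IsLocalRing R] {x : R}
    (hx : x ∈ maximalIdeal R) : IsLocalRing (R ⧸ Ideal.span {x}) := by
  have hle : Ideal.span {x} ≤ maximalIdeal R := by rwa [Ideal.span_singleton_le_iff_mem]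
  have : Nontrivial (R ⧸ Ideal.span {x}) :=
    Ideal.Quotient.nontrivial_iff.mpr (ne_top_of_le_ne_top (maximalIdeal.isMaximal R).ne_top hle)
  exact .of_surjective' (Ideal.Quotient.mk _) Ideal.Quotient.mk_surjective

lemma maximalIdeal_quotient_span_singleton {R : Type*} [CommRing R] [IsLocalRing R] (x : R)
    [IsLocalRing (R ⧸ Ideal.span {x})] :
    maximalIdeal (R ⧸ Ideal.span {x}) =
      (maximalIdeal R).map (Ideal.Quotient.mk (Ideal.span {x})) := by
  have : IsLocalHom (Ideal.Quotient.mk (Ideal.span {x})) :=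
    IsLocalHom.of_surjective _ Ideal.Quotient.mk_surjective
  rw [← IsLocalRing.maximalIdeal_comap (Ideal.Quotient.mk (Ideal.span {x})),
    Ideal.map_comap_of_surjective _ Ideal.Quotient.mk_surjective]

lemma spanFinrank_ofList_le {R : Type*} [CommRing R] (rs : List R) :
    (Ideal.ofList rs).spanFinrank ≤ rs.length := by
  classical
  have h : {r | r ∈ rs} = (rs.toFinset : Set R) := by ext; simp
  refine (Submodule.spanFinrank_span_le_ncard_of_finite (by rw [h]; exact rs.toFinset.finite_toSet)).trans ?_
  rw [h, Set.ncard_coe_finset]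
  exact rs.toFinset_card_le

/-- If the maximal ideal of `R` is generated by `dim R` elements, the quotient by one of them is
regular of dimension one less. -/
lemma isRegularLocalRing_quotient_of_ofList {R : Type*} [CommRing R] [IsLocalRing R]
    [IsNoetherianRing R] {x : R} {rs : List R} (h : Ideal.ofList (x :: rs) = maximalIdeal R)
    (hd : ringKrullDim R = (rs.length + 1 : ℕ)) :
    ∃ _ : IsRegularLocalRing (R ⧸ Ideal.span {x}),
      Ideal.ofList (rs.map (Ideal.Quotient.mk (Ideal.span {x}))) =
        maximalIdeal (R ⧸ Ideal.span {x}) ∧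
      ringKrullDim (R ⧸ Ideal.span {x}) = (rs.length : ℕ) := by
  have hx : x ∈ maximalIdeal R := h ▸ Ideal.subset_span (by simp)
  have := isLocalRing_quotient_span_singleton hx
  have hm : Ideal.ofList (rs.map (Ideal.Quotient.mk (Ideal.span {x}))) =
      maximalIdeal (R ⧸ Ideal.span {x}) := by
    rw [maximalIdeal_quotient_span_singleton, ← h, Ideal.ofList_cons, Ideal.map_sup,
      Ideal.map_quotient_self, bot_sup_eq, Ideal.map_ofList]
  have h1 : (maximalIdeal (R ⧸ Ideal.span {x})).spanFinrank ≤ rs.length := by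
    rw [← hm]
    exact (spanFinrank_ofList_le _).trans (by simp)
  have h2 := ringKrullDim_le_spanFinrank_maximalIdeal (R ⧸ Ideal.span {x})
  have h3 := ringKrullDim_le_ringKrullDim_quotient_add_card {x}
    (by simpa [IsLocalRing.ringJacobson_eq_maximalIdeal] using hx)
  rw [hd, Finset.coe_singleton, Finset.card_singleton, Nat.cast_add,
    Nat.cast_one, ENat.WithBot.add_le_add_one_right_iff] at h3
  have h4 : ((maximalIdeal (R ⧸ Ideal.span {x})).spanFinrank : WithBot ℕ∞) ≤ rs.length := by
    exact_mod_cast h1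
  exact ⟨.of_spanFinrank_maximalIdeal_le _ (h4.trans h3), hm, le_antisymm (h2.trans h4) h3⟩

lemma exists_ofList_eq_maximalIdeal (R : Type*) [CommRing R] [IsRegularLocalRing R] {n : ℕ}
    (hd : ringKrullDim R = n) : ∃ rs : List R, rs.length = n ∧ Ideal.ofList rs = maximalIdeal R := by
  obtain ⟨X, hc, hX⟩ := 
    Submodule.FG.exists_span_finset_card_eq_spanFinrank (maximalIdeal R).fg_of_isNoetherianRing
  refine ⟨X.toList, ?_, ?_⟩
  · have := (isRegularLocalRing_iff R).mp inferInstance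
    rw [hd] at this
    rw [Finset.length_toList, hc]
    exact_mod_cast this
  · rw [← hX]
    simp [Ideal.ofList, Ideal.span]

/-- Exchange argument: outside the square of the maximal ideal, `x` has a unit coefficient on some
minimal generator and can replace it. -/
lemma exists_ofList_cons_eq_maximalIdeal (R : Type*) [CommRing R] [IsRegularLocalRing R] {n : ℕ}
    (hd : ringKrullDim R = (n + 1 : ℕ)) {x : R} (hx : x ∈ maximalIdeal R)
    (hx2 : x ∉ maximalIdeal R ^ 2) :
    ∃ rs : List R, rs.length = n ∧ Ideal.ofList (x :: rs) = maximalIdeal R := by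
  classical
  obtain ⟨X, hc, hX⟩ := 
    Submodule.FG.exists_span_finset_card_eq_spanFinrank (maximalIdeal R).fg_of_isNoetherianRing
  have hXm : ∀ i ∈ X, i ∈ maximalIdeal R := fun i hi => hX ▸ Submodule.subset_span hi
  have hcard : X.card = n + 1 := by
    have := (isRegularLocalRing_iff R).mp inferInstance
    rw [hd] at this
    rw [hc]
    exact_mod_cast this
  obtain ⟨a, -, ha⟩ := Submodule.mem_span_finset.mp (hX ▸ hx)
  obtain ⟨i, hi, hu⟩ : ∃ i ∈ X, IsUnit (a i) := by
    by_contra! hcon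
    refine hx2 (ha ▸ Ideal.sum_mem _ fun i hi => ?_)
    rw [pow_two]
    exact Ideal.mul_mem_mul ((mem_maximalIdeal _).mpr (hcon i hi)) (hXm i hi)
  refine ⟨(X.erase i).toList, by simp [Finset.card_erase_of_mem hi, hcard], ?_⟩
  have hset : Ideal.ofList (x :: (X.erase i).toList) =
      Ideal.span {x} ⊔ Ideal.span (X.erase i : Set R) := by
    rw [Ideal.ofList_cons, Ideal.ofList]
    congr 2
    ext
    simp [and_comm]
  rw [hset]
  refine le_antisymm (sup_le (by rwa [Ideal.span_singleton_le_iff_mem])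
    (Ideal.span_le.mpr fun j hj => hXm j (Finset.mem_of_mem_erase hj))) ?_
  rw [← hX]
  refine Submodule.span_le.mpr fun j hj => ?_
  by_cases hji : j = i
  · subst hji
    rw [← Finset.add_sum_erase _ _ hi] at ha
    have : a j • j ∈ Ideal.span {x} ⊔ Ideal.span (X.erase j : Set R) := by
      rw [← eq_sub_iff_add_eq] at ha
      rw [ha]
      exact sub_mem (Ideal.mem_sup_left (Ideal.mem_span_singleton_self x))
        (Ideal.mem_sup_right (Ideal.sum_mem _ fun k hk =>
          Ideal.mul_mem_left _ _ (Ideal.subset_span hk)))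
    exact (Ideal.unit_mul_mem_iff_mem _ hu).mp this
  · exact Ideal.mem_sup_right (Ideal.subset_span (Finset.mem_coe.mpr (Finset.mem_erase.mpr ⟨hji, hj⟩)))

lemma isField_of_ringKrullDim_eq_zero {R : Type*} [CommRing R] [IsRegularLocalRing R]
    (hd : ringKrullDim R = 0) : IsField R := by
  have := (isRegularLocalRing_iff R).mp inferInstance
  rw [hd] at this
  rw [isField_iff_maximalIdeal_eq, ← Submodule.spanFinrank_eq_zero_iff_eq_bot
    (maximalIdeal R).fg_of_isNoetherianRing]
  exact_mod_cast this

/-- A regular local ring is a domain. -/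
lemma isDomain_of_isRegularLocalRing (n : ℕ) (R : Type u) [CommRing R] [IsRegularLocalRing R]
    (hd : ringKrullDim R = n) : IsDomain R := by
  induction n generalizing R with
  | zero => exact (isField_of_ringKrullDim_eq_zero hd).isDomain
  | succ n ih =>
    have hne : maximalIdeal R ≠ ⊥ := fun h => by
      have := ringKrullDim_eq_zero_of_isField (isField_iff_maximalIdeal_eq.mpr h)
      rw [hd] at this
      exact n.succ_ne_zero (by exact_mod_cast this)
    have hjac : maximalIdeal R ≤ (⊥ : Ideal R).jacobson := by
      rw [jacobson_eq_maximalIdeal _ bot_ne_top]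
    have h2 : ¬ maximalIdeal R ≤ maximalIdeal R ^ 2 := fun h =>
      hne (Submodule.eq_bot_of_le_smul_of_le_jacobson_bot _ _
        (maximalIdeal R).fg_of_isNoetherianRing (by rwa [smul_eq_mul, ← pow_two]) hjac)
    have hmin : ∀ p ∈ minimalPrimes R, ¬ maximalIdeal R ≤ p := by
      intro p hp hle
      have hpp : p.IsPrime := hp.1.1
      have : p = maximalIdeal R := le_antisymm (le_maximalIdeal hpp.ne_top) hle
      subst this
      have h0 := maximalIdeal_height_eq_ringKrullDim (R := R)
      rw [Ideal.height_eq_zero_iff.mpr hp, hd] at h0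
      exact n.succ_ne_zero (by exact_mod_cast h0.symm)
    -- Prime avoidance tolerates two non-prime ideals; the square of the maximal ideal fills both
    -- slots.
    obtain ⟨x, hx, hxn⟩ : ∃ x ∈ maximalIdeal R,
        x ∉ ⋃ I ∈ insert (maximalIdeal R ^ 2) (minimalPrimes R), (I : Set R) := by
      by_contra! hcon
      obtain ⟨I, hI, hle⟩ := (Ideal.subset_union_prime_finite (f := id)
        ((minimalPrimes.finite_of_isNoetherianRing R).insert (maximalIdeal R ^ 2))
        (maximalIdeal R ^ 2) (maximalIdeal R ^ 2) (fun I hI h _ => by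
          rcases hI with rfl | hI
          · exact absurd rfl h
          · exact hI.1.1)).mp hcon
      rcases hI with rfl | hI
      · exact h2 hle
      · exact hmin I hI hle
    simp only [Set.mem_iUnion, not_exists, Set.mem_insert_iff] at hxn
    obtain ⟨rs, hl, hrs⟩ := exists_ofList_cons_eq_maximalIdeal R hd hx (hxn _ (Or.inl rfl))
    obtain ⟨hreg, -, hdim⟩ := isRegularLocalRing_quotient_of_ofList hrs (by rw [hd, hl])
    have := ih _ (hl ▸ hdim)
    have hprime : (Ideal.span {x}).IsPrime := (Ideal.Quotient.isDomain_iff_prime _).mp this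
    obtain ⟨p, hp, hpx⟩ := Ideal.exists_minimalPrimes_le (bot_le (a := Ideal.span {x}))
    have hpp : p.IsPrime := hp.1.1
    have hxp : x ∉ p := hxn p (Or.inr hp)
    -- A minimal prime `p` inside `(x)` with `x ∉ p` satisfies `p = x p`, so Nakayama gives `p = 0`.
    have : p = ⊥ := by
      refine Submodule.eq_bot_of_le_smul_of_le_jacobson_bot _ _ p.fg_of_isNoetherianRing ?_ hjac
      intro y hy
      obtain ⟨a, rfl⟩ := Ideal.mem_span_singleton'.mp (hpx hy)
      rw [mul_comm]
      exact Submodule.smul_mem_smul hx ((hpp.mem_or_mem hy).resolve_right hxp)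
    subst this
    exact (IsDomain.of_bot_isPrime R)

/-- Generators of the maximal ideal of a regular local ring, in minimal number, form a regular
sequence. -/
lemma isWeaklyRegular_of_ofList_eq_maximalIdeal (R : Type u) [CommRing R] [IsRegularLocalRing R]
    (rs : List R) (h : Ideal.ofList rs = maximalIdeal R) (hd : ringKrullDim R = rs.length) :
    RingTheory.Sequence.IsWeaklyRegular R rs := by
  generalize hl : rs.length = n
  induction n generalizing R with
  | zero => rw [List.length_eq_zero_iff.mp hl]; exact .nil _ _
  | succ n ih =>
    obtain _ | ⟨x, rs⟩ := rs
    · simp at hl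
    simp only [List.length_cons, Nat.add_right_cancel_iff] at hl hd
    have := isDomain_of_isRegularLocalRing _ R hd
    obtain ⟨hreg, hm, hdim⟩ := isRegularLocalRing_quotient_of_ofList h hd
    rw [RingTheory.Sequence.isWeaklyRegular_cons_iff']
    constructor
    -- If `x = 0`, the maximal ideal has fewer generators than the dimension.
    · refine IsSMulRegular.of_ne_zero (fun hx => ?_)
      subst hx
      have h1 := ringKrullDim_le_spanFinrank_maximalIdeal R
      rw [← h, hd, Ideal.ofList_cons] at h1
      have h2 := spanFinrank_ofList_le rs
      simp only [Ideal.span_singleton_zero, bot_sup_eq] at h1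
      have h1 : rs.length + 1 ≤ (Ideal.ofList rs).spanFinrank := by exact_mod_cast h1
      omega
    · have := ih (R ⧸ Ideal.span {x}) (rs.map (Ideal.Quotient.mk _)) hm (by simpa using hdim)
        (by simpa using hl)
      refine (LinearEquiv.isWeaklyRegular_congr (R := R ⧸ Ideal.span {x}) ?_ _).mp this
      exact LinearEquiv.extendScalarsOfSurjective Ideal.Quotient.mk_surjective
        (Submodule.quotEquivOfEq _ _ (by simp [← Submodule.ideal_span_singleton_smul]))

lemma IsSMulRegular.of_flat_module {R F : Type*} [CommRing R] [AddCommGroup F] [Module R F]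
    [Module.Flat R F] {x : R} (hx : IsSMulRegular R x) : IsSMulRegular F x :=
  Module.Flat.isSMulRegular_of_nonZeroDivisors (mem_nonZeroDivisors_iff_right.mpr
    fun y h => hx.right_eq_zero_of_smul (by rwa [smul_eq_mul, mul_comm]))

/-- If `x • z` lies in the kernel then `x • f z = 0`, so `z` does too. Thus reduction modulo `x`
preserves short exactness. -/
lemma QuotSMulTop.map_subtype_injective {R F K : Type*} [CommRing R] [AddCommGroup F] [Module R F]
    [AddCommGroup K] [Module R K] {x : R} (f : F →ₗ[R] K) (hx : IsSMulRegular K x) :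
    Function.Injective (QuotSMulTop.map x (LinearMap.ker f).subtype) := by
  rw [injective_iff_map_eq_zero]
  intro y hy
  obtain ⟨y, rfl⟩ := Submodule.Quotient.mk_surjective _ y
  rw [QuotSMulTop.map_apply_mk, Submodule.Quotient.mk_eq_zero,
    Submodule.mem_smul_pointwise_iff_exists] at hy
  obtain ⟨z, -, hz⟩ := hy
  have hfz : f z = 0 := by
    apply hx.right_eq_zero_of_smul
    rw [← map_smul, hz]
    exact y.2
  rw [Submodule.Quotient.mk_eq_zero, Submodule.mem_smul_pointwise_iff_exists]
  exact ⟨⟨z, hfz⟩, trivial, Subtype.ext hz⟩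

/-- Projective dimension can be bounded after reduction modulo a regular element. -/
lemma hasProjectiveDimensionLE_of_quotSMulTop {R : Type u} [CommRing R] [IsLocalRing R]
    [IsNoetherianRing R] {x : R} (hx : x ∈ maximalIdeal R) (hxR : IsSMulRegular R x) (n : ℕ)
    (K : Type u) [AddCommGroup K] [Module R K] [Module.Finite R K] (hxK : IsSMulRegular K x)
    (h : HasProjectiveDimensionLE (ModuleCat.of (R ⧸ Ideal.span {x}) (QuotSMulTop x K)) n) :
    HasProjectiveDimensionLE (ModuleCat.of R K) n := by
  have := isLocalRing_quotient_span_singleton hx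
  induction n generalizing K with
  | zero =>
    have := projective_iff_hasProjectiveDimensionLT_one.mpr h
    have : Module.Projective (R ⧸ Ideal.span {x}) (QuotSMulTop x K) :=
      (IsProjective.iff_projective _).mpr this
    have : Module.FinitePresentation R K := Module.finitePresentation_of_finite R K
    have : Module.Finite (R ⧸ Ideal.span {x}) (QuotSMulTop x K) :=
      Module.Finite.of_restrictScalars_finite R _ _
    have : Module.Free (R ⧸ Ideal.span {x}) (QuotSMulTop x K) :=
      Module.free_of_flat_of_isLocalRing
    have : Module.Free R K := (Module.free_quotSMulTop_iff_free R K
      (by rwa [jacobson_eq_maximalIdeal _ bot_ne_top]) hxK).mp this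
    exact projective_iff_hasProjectiveDimensionLT_one.mp
      ((IsProjective.iff_projective _).mp (inferInstanceAs (Module.Projective R K)))
  | succ n ih =>
    obtain ⟨F, _, _, _, _, f, hf⟩ := Module.exists_finite_presentation R K
    have hS := LinearMap.shortExact_shortComplexKer hf
    have hproj : Projective f.shortComplexKer.X₂ :=
      ModuleCat.projective_of_categoryTheory_projective f.shortComplexKer.X₂
    have hxF : IsSMulRegular F x := hxR.of_flat_module
    have hxk : IsSMulRegular (LinearMap.ker f) x :=
      hxF.of_injective _ (LinearMap.ker f).injective_subtype
    refine (hS.hasProjectiveDimensionLT_X₃_iff n hproj).mpr (ih (LinearMap.ker f) hxk ?_)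
    let i := LinearMap.extendScalarsOfSurjective (S := R ⧸ Ideal.span {x})
      Ideal.Quotient.mk_surjective (QuotSMulTop.map x (LinearMap.ker f).subtype)
    let p := LinearMap.extendScalarsOfSurjective (S := R ⧸ Ideal.span {x})
      Ideal.Quotient.mk_surjective (QuotSMulTop.map x f)
    have hex : Function.Exact i p := QuotSMulTop.map_exact x (LinearMap.exact_subtype_ker_map f) hf
    have hT : (ModuleCat.shortComplexOfCompEqZero i p hex.linearMap_comp_eq_zero).ShortExact :=
      { exact := ModuleCat.shortComplex_exact _ hex
        mono_f := (ModuleCat.mono_iff_injective _).mpr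
          (QuotSMulTop.map_subtype_injective f hxK)
        epi_g := (ModuleCat.epi_iff_surjective _).mpr (QuotSMulTop.map_surjective x hf) }
    have hprojT : Projective (ModuleCat.of (R ⧸ Ideal.span {x}) (QuotSMulTop x F)) :=
      (IsProjective.iff_projective _).mp
        (inferInstanceAs (Module.Projective (R ⧸ Ideal.span {x}) (QuotSMulTop x F)))
    exact (hT.hasProjectiveDimensionLT_X₃_iff n hprojT).mp h

/-- Finite modules over a regular local ring have projective dimension at most its dimension. -/
lemma hasProjectiveDimensionLE_of_isRegularLocalRing (n : ℕ) (R : Type u) [CommRing R]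
    [IsRegularLocalRing R] (hd : ringKrullDim R = n) (M : Type u) [AddCommGroup M] [Module R M]
    [Module.Finite R M] : HasProjectiveDimensionLE (ModuleCat.of R M) n := by
  induction n generalizing R M with
  | zero =>
    let := (isField_of_ringKrullDim_eq_zero hd).toField
    exact projective_iff_hasProjectiveDimensionLT_one.mp
      ((IsProjective.iff_projective _).mp (inferInstanceAs (Module.Projective R M)))
  | succ n ih =>
    obtain ⟨rs, hl, hrs⟩ := exists_ofList_eq_maximalIdeal R hd
    have hw := isWeaklyRegular_of_ofList_eq_maximalIdeal R rs hrs (by rw [hd, hl])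
    obtain _ | ⟨x, rs⟩ := rs
    · simp at hl
    simp only [List.length_cons, Nat.add_right_cancel_iff] at hl
    have hx : x ∈ maximalIdeal R := hrs ▸ Ideal.subset_span (by simp)
    have hxR : IsSMulRegular R x := ((RingTheory.Sequence.isWeaklyRegular_cons_iff _ _ _).mp hw).1
    obtain ⟨hreg, -, hdim⟩ := isRegularLocalRing_quotient_of_ofList hrs (by rw [hd, hl])
    obtain ⟨F, _, _, _, _, f, hf⟩ := Module.exists_finite_presentation R M
    have hS := LinearMap.shortExact_shortComplexKer hf
    have hproj : Projective f.shortComplexKer.X₂ :=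
      ModuleCat.projective_of_categoryTheory_projective f.shortComplexKer.X₂
    -- `M` may have `x`-torsion; its syzygy, a submodule of a free module, has none, and is reduced
    -- modulo `x` instead.
    have hxF : IsSMulRegular F x := hxR.of_flat_module
    have hxk : IsSMulRegular (LinearMap.ker f) x :=
      hxF.of_injective _ (LinearMap.ker f).injective_subtype
    have : Module.Finite (R ⧸ Ideal.span {x}) (QuotSMulTop x (LinearMap.ker f)) :=
      Module.Finite.of_restrictScalars_finite R _ _
    exact (hS.hasProjectiveDimensionLT_X₃_iff n hproj).mpr
      (hasProjectiveDimensionLE_of_quotSMulTop hx hxR n _ hxk (ih _ (hl ▸ hdim) _))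

/-- Over a regular local ring, a finite module of depth zero has projective dimension equal to the
dimension of the ring. -/
lemma projectiveDimension_eq_ringKrullDim (R : Type u) [CommRing R]
    [IsRegularLocalRing R] (M : Type u) [AddCommGroup M] [Module R M]
    [Module.Finite R M] (hM : maximalIdeal R ∈ associatedPrimes R M) :
    projectiveDimension (ModuleCat.of R M) = ringKrullDim R := by
  have hd := (isRegularLocalRing_iff R).mp inferInstance
  generalize (maximalIdeal R).spanFinrank = n at hd
  have hn (N : Type u) [AddCommGroup N] [Module R N] [Module.Finite R N] :=
    hasProjectiveDimensionLE_of_isRegularLocalRing n R hd.symm N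
  rw [← hd]
  refine le_antisymm ((projectiveDimension_le_iff _ _).mpr (hn M)) ?_
  rw [projectiveDimension_ge_iff]
  intro hlt
  obtain ⟨rs, hl, hrs⟩ := exists_ofList_eq_maximalIdeal R hd.symm
  have hw := isWeaklyRegular_of_ofList_eq_maximalIdeal R rs hrs (by rw [← hd, hl])
  have hr : RingTheory.Sequence.IsRegular R rs :=
    RingTheory.Sequence.IsRegular.of_isWeaklyRegular_of_mem_maximalIdeal _
      (fun r hr => hrs ▸ Ideal.subset_span hr) hw
  have hk : projectiveDimension (ModuleCat.of R (R ⧸ maximalIdeal R)) = n := by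
    rw [← hrs, ← hl, ← ModuleCat.projectiveDimension_quotient_eq_length rs hr]
    exact projectiveDimension_eq_of_iso (Shrink.linearEquiv R (R ⧸ Ideal.ofList rs)).symm.toModuleIso
  -- The residue field embeds in `M` with cokernel of projective dimension at most `n`, so `pd M <
  -- n` would force the same bound on the residue field.
  obtain ⟨-, f, hf⟩ := (isAssociatedPrime_iff_exists_injective_linearMap _ _).mp hM
  have hex : Function.Exact f (LinearMap.range f).mkQ := by
    rw [LinearMap.exact_iff, Submodule.ker_mkQ]
  have hT : (ModuleCat.shortComplexOfCompEqZero f _ hex.linearMap_comp_eq_zero).ShortExact :=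
    { exact := ModuleCat.shortComplex_exact _ hex
      mono_f := (ModuleCat.mono_iff_injective _).mpr hf
      epi_g := (ModuleCat.epi_iff_surjective _).mpr (Submodule.mkQ_surjective _) }
  exact (projectiveDimension_ge_iff _ _).mp hk.ge
    (hT.hasProjectiveDimensionLT_X₁ n hlt (hn (M ⧸ LinearMap.range f)))

end RegularLocalRing

/-! ### Annihilators of the top `Ext` and projective dimension after localization. -/

section Ext

open Abelian

/-- Over a localization, a finite module becomes projective iff multiplication by some element of
the submonoid factors through a given projective cover. -/
lemma projective_localizedModule_iff {R F M : Type*} [CommRing R] [AddCommGroup F] [Module R F]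
    [AddCommGroup M] [Module R M] (T : Submonoid R) [Module.FinitePresentation R M]
    [Module.Projective R F] (f : F →ₗ[R] M) (hf : Function.Surjective f) :
    Module.Projective (Localization T) (LocalizedModule T M) ↔
      ∃ s ∈ T, ∃ g : M →ₗ[R] F, f ∘ₗ g = s • LinearMap.id := by
  have : Module.Projective (Localization T) (LocalizedModule T F) :=
    Module.projective_of_isLocalizedModule T (LocalizedModule.mkLinearMap T F)
  constructor
  · intro h
    obtain ⟨σ, hσ⟩ := Module.projective_lifting_property (LocalizedModule.map T f)
      (LinearMap.id) (LocalizedModule.map_surjective T f hf)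
    obtain ⟨g, s, hs⟩ := Module.FinitePresentation.exists_lift_of_isLocalizedModule T
      (LocalizedModule.mkLinearMap T F)
      ((σ.restrictScalars R) ∘ₗ LocalizedModule.mkLinearMap T M)
    have key : ∀ m : M, ∃ c : T, c • (f (g m)) = c • ((s : R) • m) := by
      intro m
      apply IsLocalizedModule.exists_of_eq (S := T) (f := LocalizedModule.mkLinearMap T M)
      have h1 := LinearMap.congr_fun hs m
      have h2 := congrArg (LocalizedModule.map T f) h1
      have h3 := LinearMap.congr_fun hσ (LocalizedModule.mk m 1)
      simp only [LinearMap.comp_apply, LinearMap.smul_apply, LinearMap.restrictScalars_apply,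
        LocalizedModule.mkLinearMap_apply, LinearMap.id_apply, Submonoid.smul_def] at h2 h3 ⊢
      rw [LocalizedModule.map_mk] at h2
      rw [h2, ← algebraMap_smul (Localization T) (s : R), map_smul, h3, algebraMap_smul,
        LocalizedModule.smul'_mk]
    obtain ⟨G, hG⟩ := Module.Finite.fg_top (R := R) (M := M)
    choose c hc using key
    classical
    -- The product over finitely many generators is a common denominator.
    refine ⟨((∏ m ∈ G, c m) * s : T), SetLike.coe_mem _, ((∏ m ∈ G, c m : T) : R) • g, ?_⟩
    refine LinearMap.ext_on hG fun m hm => ?_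
    obtain ⟨d, hd⟩ := Finset.dvd_prod_of_mem c hm
    simp only [LinearMap.comp_smul, LinearMap.smul_apply, LinearMap.comp_apply, LinearMap.id_apply]
    have := hc m
    simp only [Submonoid.smul_def] at this
    rw [hd, mul_comm (c m), Submonoid.coe_mul, Submonoid.coe_mul, Submonoid.coe_mul, mul_smul, this,
      mul_smul, mul_smul]
  · rintro ⟨s, hs, g, hg⟩
    obtain ⟨u, hu⟩ : IsUnit (algebraMap R (Localization T) s) :=
      IsLocalization.map_units _ ⟨s, hs⟩
    refine Module.Projective.of_split ((↑u⁻¹ : Localization T) • LocalizedModule.map T g)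
      (LocalizedModule.map T f) ?_
    ext x
    induction x using LocalizedModule.induction_on with
    | h m t =>
      have h := LinearMap.congr_fun hg m
      simp only [LinearMap.comp_apply, LinearMap.smul_apply, LinearMap.id_apply, map_smul,
        LocalizedModule.map_mk] at h ⊢
      rw [h, ← LocalizedModule.smul'_mk, ← algebraMap_smul (Localization T) s, ← hu, smul_smul,
        Units.inv_mul, one_smul]


lemma exists_smul_eq_zero_of_subsingleton_localizedModule {R M : Type*} [CommRing R]
    [AddCommGroup M] [Module R M] [Module.Finite R M] (T : Submonoid R)
    (h : Subsingleton (LocalizedModule T M)) : ∃ s ∈ T, ∀ m : M, s • m = 0 := by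
  rw [LocalizedModule.subsingleton_iff] at h
  choose c hcT hc using h
  obtain ⟨G, hG⟩ := Module.Finite.fg_top (R := R) (M := M)
  refine ⟨∏ m ∈ G, c m, Submonoid.prod_mem _ fun m _ => hcT m, fun m => ?_⟩
  have : (∏ m ∈ G, c m) • (LinearMap.id : M →ₗ[R] M) = 0 := by
    refine LinearMap.ext_on hG fun m hm => ?_
    obtain ⟨d, hd⟩ := Finset.dvd_prod_of_mem c hm
    simp [hd, mul_comm (c m), mul_smul, hc m]
  exact LinearMap.congr_fun this m

lemma smul_eq_zero_of_forall_dual {R M : Type*} [CommRing R] [AddCommGroup M] [Module R M]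
    [Module.Projective R M] {s : R} (h : ∀ φ : M →ₗ[R] R, s • φ = 0) (m : M) :
    s • m = 0 := by
  rw [← Module.forall_dual_apply_eq_zero_iff R]
  intro φ
  rw [map_smul]
  exact LinearMap.congr_fun (h φ) m

/-- `K` is a retract of some `R^n`: extend `s` times each coordinate functional to `F`, then project
back to `K`. -/
lemma exists_smul_id_of_forall_dual {R K F : Type*} [CommRing R] [AddCommGroup K] [Module R K]
    [AddCommGroup F] [Module R F] [Module.Projective R K] [Module.Finite R K] {s : R}
    (i : K →ₗ[R] F) (h : ∀ φ : K →ₗ[R] R, ∃ ψ : F →ₗ[R] R, ψ ∘ₗ i = s • φ) :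
    ∃ r : F →ₗ[R] K, r ∘ₗ i = s • LinearMap.id := by
  obtain ⟨n, p, j, -, -, hpj⟩ := Module.Finite.exists_comp_eq_id_of_projective R K
  choose ψ hψ using fun k : Fin n => h (LinearMap.proj k ∘ₗ j)
  refine ⟨p ∘ₗ LinearMap.pi ψ, ?_⟩
  have : LinearMap.pi ψ ∘ₗ i = s • j := by
    ext x k
    exact LinearMap.congr_fun (hψ k) x
  rw [LinearMap.comp_assoc, this, LinearMap.comp_smul, hpj]

/-- The map `s • id - r` on `F` vanishes on `ker f`, so it descends to `M`. -/
lemma exists_comp_eq_smul_id_of_retraction {R F M : Type*} [CommRing R] [AddCommGroup M]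
    [Module R M] [AddCommGroup F] [Module R F] {s : R} {f : F →ₗ[R] M}
    (hf : Function.Surjective f) (r : F →ₗ[R] LinearMap.ker f)
    (hr : r ∘ₗ (LinearMap.ker f).subtype = s • LinearMap.id) :
    ∃ g : M →ₗ[R] F, f ∘ₗ g = s • LinearMap.id := by
  refine ⟨(LinearMap.ker f).liftQ (s • LinearMap.id - (LinearMap.ker f).subtype ∘ₗ r) ?_ ∘ₗ
    (f.quotKerEquivOfSurjective hf).symm.toLinearMap, ?_⟩
  · intro x hx
    have := congrArg Subtype.val (LinearMap.congr_fun hr ⟨x, hx⟩)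
    simp only [LinearMap.comp_apply, Submodule.subtype_apply, LinearMap.smul_apply,
      LinearMap.id_apply, Submodule.coe_smul] at this
    simp [this]
  · ext m
    obtain ⟨x, rfl⟩ := hf m
    have : (f.quotKerEquivOfSurjective hf).symm (f x) = Submodule.Quotient.mk x := by
      rw [LinearEquiv.symm_apply_eq]; rfl
    simp only [LinearMap.comp_apply, LinearEquiv.coe_coe, this]
    simp

/-- For `M` finite of projective dimension at most `n`, an element of `T` kills `Ext^n(M, R)` iff
the localization of `M` at `T` has projective dimension less than `n`. -/
lemma exists_annihilator_ext_iff {R : Type u} [CommRing R] [IsNoetherianRing R]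
    (T : Submonoid R) (n : ℕ) (M : ModuleCat.{u} R) [Module.Finite R M]
    [HasProjectiveDimensionLE M n] :
    (∃ s ∈ T, ∀ x : Ext M (ModuleCat.of R R) n, s • x = 0) ↔
      HasProjectiveDimensionLT (M.localizedModule T) n := by
  induction n generalizing M with
  | zero =>
    rw [hasProjectiveDimensionLT_zero_iff_isZero, ModuleCat.isZero_iff_subsingleton]
    have e : Subsingleton (M.localizedModule T) ↔ Subsingleton (LocalizedModule T M) :=
      (equivShrink _).symm.subsingleton_congr
    rw [e]
    constructor
    · rintro ⟨s, hs, h⟩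
      have : Projective M := projective_iff_hasProjectiveDimensionLT_one |>.mpr ‹_›
      have : Module.Projective R M := (IsProjective.iff_projective _).mpr this
      rw [LocalizedModule.subsingleton_iff]
      intro m
      refine ⟨s, hs, smul_eq_zero_of_forall_dual (fun φ => ?_) m⟩
      have := h (Ext.mk₀ (ModuleCat.ofHom φ))
      rw [← Ext.mk₀_smul, Ext.mk₀_eq_zero_iff] at this
      exact congrArg ModuleCat.Hom.hom this
    · intro h
      obtain ⟨s, hs, h⟩ := exists_smul_eq_zero_of_subsingleton_localizedModule T h
      refine ⟨s, hs, fun x => ?_⟩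
      obtain ⟨φ, rfl⟩ := (Ext.mk₀_bijective _ _).2 x
      rw [← Ext.mk₀_smul, Ext.mk₀_eq_zero_iff]
      ext m
      change s • φ m = 0
      rw [← map_smul, h, map_zero]
  | succ n ih =>
    obtain ⟨F, _, _, _, _, f, hf⟩ := Module.exists_finite_presentation R M
    have hS := LinearMap.shortExact_shortComplexKer hf
    let S := f.shortComplexKer
    have hproj : Projective S.X₂ := ModuleCat.projective_of_categoryTheory_projective S.X₂
    have hK : HasProjectiveDimensionLE S.X₁ n :=
      (hS.hasProjectiveDimensionLT_X₃_iff n hproj).mp ‹HasProjectiveDimensionLE M (n + 1)›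
    -- Degree one is separate: the connecting map from `Hom(K, R)` to `Ext^1(M, R)` need not be
    -- injective. In higher degrees it is an isomorphism, and dimension shifting applies.
    match n with
    | 0 =>
      rw [← projective_iff_hasProjectiveDimensionLT_one, ← IsProjective.iff_projective]
      have : Module.FinitePresentation R M := Module.finitePresentation_of_finite R M
      have e : Module.Projective (Localization T) (Shrink.{u} (LocalizedModule T M)) ↔
          Module.Projective (Localization T) (LocalizedModule T M) :=
        ⟨fun _ => .of_equiv (Shrink.linearEquiv.{u} (Localization T) (LocalizedModule T M)),
          fun _ => .of_equiv (Shrink.linearEquiv.{u} (Localization T) (LocalizedModule T M)).symm⟩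
      refine Iff.trans ?_ e.symm
      rw [projective_localizedModule_iff T f hf]
      constructor
      · rintro ⟨s, hs, h⟩
        have : Projective S.X₁ := projective_iff_hasProjectiveDimensionLT_one |>.mpr ‹_›
        have : Module.Projective R (LinearMap.ker f) := (IsProjective.iff_projective _).mpr this
        obtain ⟨r, hr⟩ := exists_smul_id_of_forall_dual (s := s) (LinearMap.ker f).subtype
          (fun φ => by
            have h1 : hS.extClass.comp (Ext.mk₀ (ModuleCat.ofHom (s • φ))) (add_zero 1) = 0 := by
              rw [show ModuleCat.ofHom (s • φ) = s • ModuleCat.ofHom φ from rfl, Ext.mk₀_smul, Ext.comp_smul, h]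
            obtain ⟨y, hy⟩ := Ext.contravariant_sequence_exact₁ hS _ _ _ h1
            obtain ⟨ψ, rfl⟩ := (Ext.mk₀_bijective _ _).2 y
            rw [Ext.mk₀_comp_mk₀, (Ext.mk₀_bijective _ _).1.eq_iff] at hy
            exact ⟨ψ.hom, congrArg ModuleCat.Hom.hom hy⟩)
        obtain ⟨g, hg⟩ := exists_comp_eq_smul_id_of_retraction hf r hr
        exact ⟨s, hs, g, hg⟩
      · rintro ⟨s, hs, g, hg⟩
        refine ⟨s, hs, fun x => ?_⟩
        -- Multiplication by `s` factors through `Ext^1(F, R) = 0`.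
        have h1 : s • x = (Ext.mk₀ (s • 𝟙 M)).comp x (zero_add _) := by
          rw [Ext.mk₀_smul, Ext.smul_comp, Ext.mk₀_id_comp]
        have h2 : s • 𝟙 M = ModuleCat.ofHom g ≫ S.g := by
          ext m
          exact (LinearMap.congr_fun hg m).symm
        rw [h1, h2, ← Ext.mk₀_comp_mk₀_assoc, Ext.eq_zero_of_projective
          ((Ext.mk₀ S.g).comp x (zero_add _)), Ext.comp_zero]
    | n + 1 =>
      have hST := hS.map_of_exact (ModuleCat.localizedModuleFunctor T)
      have hprojT : Projective (S.map (ModuleCat.localizedModuleFunctor T)).X₂ :=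
        (ModuleCat.localizedModuleFunctor.{u} T).projective_obj_of_projective hproj
      have h1 := hST.hasProjectiveDimensionLT_X₃_iff n hprojT
      have h2 := ih S.X₁
      refine Iff.trans (Iff.trans ?_ h2) h1.symm
      refine exists_congr fun s => and_congr_right fun _ => ⟨fun h x => ?_, fun h x => ?_⟩
      · have h3 : hS.extClass.comp (s • x) (add_comm 1 (n + 1)) = 0 := by
          rw [Ext.comp_smul, h]
        obtain ⟨y, hy⟩ := Ext.contravariant_sequence_exact₁ hS _ _ _ h3
        rw [← hy, Ext.eq_zero_of_projective y, Ext.comp_zero]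
      · obtain ⟨y, rfl⟩ := Ext.contravariant_sequence_exact₃ hS _ x
          (Ext.eq_zero_of_projective _) (add_comm 1 (n + 1))
        rw [← Ext.comp_smul, h, Ext.comp_zero]

end Ext

/-! ### Zeroth local cohomology and associated primes. -/

section LocalCohomology

open Limits Opposite localCohomology

/-- Left exactness of `Hom(-, Y)` identifies its zeroth derived functor with itself. -/
instance linearYoneda_obj_preservesFiniteLimits (R : Type u) [CommRing R] (Y : ModuleCat.{u} R) :
    PreservesFiniteLimits ((linearYoneda R (ModuleCat.{u} R)).obj Y) := by
  refine ⟨fun J _ _ => ?_⟩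
  have : PreservesLimitsOfShape J
      ((linearYoneda R (ModuleCat.{u} R)).obj Y ⋙ forget (ModuleCat.{u} R)) :=
    inferInstanceAs (PreservesLimitsOfShape J (yoneda.obj Y))
  exact preservesLimitsOfShape_of_reflects_of_preserves _ (forget (ModuleCat.{u} R))

/-- `Ext` in degree zero is the contravariant `Hom` functor. -/
noncomputable def extZeroFlipIso (R : Type u) [CommRing R] (Y : ModuleCat.{u} R) :
    (Ext R (ModuleCat.{u} R) 0).flip.obj Y ≅ (linearYoneda R (ModuleCat.{u} R)).obj Y :=
  have : PreservesFiniteColimits ((linearYoneda R (ModuleCat.{u} R)).obj Y).rightOp :=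
    preservesFiniteColimits_rightOp _
  NatIso.ofComponents
    (fun X => ((((linearYoneda R (ModuleCat.{u} R)).obj Y).rightOp.leftDerivedZeroIsoSelf).app
      X.unop).unop.symm)
    (fun {X X'} f => by
      have := (((linearYoneda R (ModuleCat.{u} R)).obj Y).rightOp.leftDerivedZeroIsoSelf).inv.naturality f.unop
      exact congrArg Quiver.Hom.unop this.symm)

/-- Local cohomology in degree zero as a colimit of `Hom` modules. -/
noncomputable def localCohomologyZeroIso {R : Type u} [CommRing R] (I : Ideal R)
    (M : ModuleCat.{u} R) :
    (localCohomology I 0).obj M ≅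
      colimit ((ringModIdeals (idealPowersDiagram I)).op ⋙
        (linearYoneda R (ModuleCat.{u} R)).obj M) :=
  have := hasColimitDiagram.{u, 0} (idealPowersDiagram I) 0
  colimitObjIsoColimitCompEvaluation (diagram (idealPowersDiagram I) 0) M ≪≫
    HasColimit.isoOfNatIso (Functor.isoWhiskerLeft (ringModIdeals (idealPowersDiagram I)).op
      (extZeroFlipIso R M))

lemma nontrivial_localCohomology_zero_iff {R : Type u} [CommRing R] (I : Ideal R)
    (M : Type u) [AddCommGroup M] [Module R M] :
    Nontrivial ((localCohomology I 0).obj (ModuleCat.of R M)) ↔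
      ∃ n : ℕ, ∃ m : M, m ≠ 0 ∧ ∀ a ∈ I ^ n, a • m = 0 := by
  rw [(localCohomologyZeroIso I (ModuleCat.of R M)).toLinearEquiv.toEquiv.nontrivial_congr]
  set F := (ringModIdeals (idealPowersDiagram I)).op ⋙
        (linearYoneda R (ModuleCat.{u} R)).obj (ModuleCat.of R M) with hF
  have : PreservesFilteredColimitsOfSize.{0, 0} (forget (ModuleCat.{u} R)) :=
    preservesFilteredColimitsOfSize_shrink.{0, u, 0, u} _
  have : PreservesColimit F (forget (ModuleCat.{u} R)) := inferInstance
  -- The maps `R/I^m → R/I^n` are surjective, so the transition maps on `Hom` are injective and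
  -- nonzero elements survive in the colimit.
  have hinj : ∀ {i j : (ℕᵒᵖ)ᵒᵖ} (f : i ⟶ j), Function.Injective (F.map f) := by
    intro i j f a b h
    have : Epi ((ringModIdeals (idealPowersDiagram I)).map f.unop) := by
      rw [ModuleCat.epi_iff_surjective]
      intro x
      obtain ⟨r, rfl⟩ := Submodule.mkQ_surjective _ x
      exact ⟨Submodule.Quotient.mk r, rfl⟩
    exact (cancel_epi ((ringModIdeals (idealPowersDiagram I)).map f.unop)).mp h
  constructor
  · intro h
    obtain ⟨x, hx⟩ := exists_ne (0 : (colimit F : ModuleCat.{u} R))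
    obtain ⟨j, y, rfl⟩ := Concrete.colimit_exists_rep F x
    have hy : y ≠ 0 := by rintro rfl; exact hx (map_zero _)
    let y' : ModuleCat.of R (R ⧸ I ^ j.unop.unop) ⟶ ModuleCat.of R M := y
    refine ⟨j.unop.unop, y' (Submodule.Quotient.mk 1), ?_, ?_⟩
    · intro h0
      apply hy
      change y' = 0
      ext
      exact h0
    · intro a ha
      rw [← map_smul, ← Submodule.Quotient.mk_smul, smul_eq_mul, mul_one,
        (Submodule.Quotient.mk_eq_zero _).mpr ha, map_zero]
  · rintro ⟨n, m, hm, ha⟩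
    let y : ModuleCat.of R (R ⧸ I ^ n) ⟶ ModuleCat.of R M :=
      ModuleCat.ofHom (Submodule.liftQ _ (LinearMap.toSpanSingleton R M m)
        (fun a h => by simpa using ha a h))
    have hy1 : y (Submodule.Quotient.mk 1) = m := by
      change (1 : R) • m = m
      simp
    let y' : F.obj (op (op n)) := y
    refine ⟨⟨colimit.ι F _ y', 0, fun h => ?_⟩⟩
    rw [← map_zero (colimit.ι F (op (op n))).hom] at h
    obtain ⟨k, f, g, hfg⟩ := Concrete.colimit_exists_of_rep_eq F _ _ h
    have hg : F.map g (0 : F.obj (op (op n))) = F.map f 0 := by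
      rw [map_zero, map_zero]
    have h0 : y' = 0 := hinj f (hfg.trans hg)
    have h0' : y = 0 := h0
    apply hm
    rw [← hy1, h0']
    rfl

lemma nontrivial_localCohomology_zero_iff_associatedPrimes {R : Type u} [CommRing R]
    [IsNoetherianRing R] (I : Ideal R) (M : Type u) [AddCommGroup M] [Module R M] :
    Nontrivial ((localCohomology I 0).obj (ModuleCat.of R M)) ↔
      ∃ P ∈ associatedPrimes R M, I ≤ P := by
  rw [nontrivial_localCohomology_zero_iff]
  constructor
  · rintro ⟨n, m, hm, h⟩
    obtain ⟨P, hP, hle⟩ := exists_le_isAssociatedPrime_of_isNoetherianRing R m hm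
    refine ⟨P, hP, hP.isPrime.le_of_pow_le (n := n) (fun a ha => hle ?_)⟩
    simpa using h a ha
  · rintro ⟨P, hP, hle⟩
    rw [AssociatedPrimes.mem_iff, isAssociatedPrime_iff] at hP
    obtain ⟨hp, m, rfl⟩ := hP
    refine ⟨1, m, ?_, fun a ha => ?_⟩
    · rintro rfl
      exact hp.ne_top (by simp)
    · rw [pow_one] at ha
      simpa using hle ha

end LocalCohomology

/-! ### Combination over a regular ring. -/

/-- At an associated prime of a finite module over a regular ring, the localized module has
projective dimension equal to the height of the prime. -/
lemma projectiveDimension_localizedModule_eq_height {S : Type u} [CommRing S] [IsRegularRing S]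
    (M : Type u) [AddCommGroup M] [Module S M] [Module.Finite S M] (P : Ideal S) [P.IsPrime]
    (hP : P ∈ associatedPrimes S M) :
    projectiveDimension ((ModuleCat.of S M).localizedModule P.primeCompl) = P.height := by
  have hass := Module.associatedPrimes.mem_associatedPrimes_atPrime_of_mem_associatedPrimes hP
  rw [← IsLocalization.AtPrime.ringKrullDim_eq_height P (Localization.AtPrime P),
    ← projectiveDimension_eq_ringKrullDim (Localization.AtPrime P)
      (LocalizedModule P.primeCompl M) hass]
  exact projectiveDimension_eq_of_iso (Shrink.linearEquiv.{u} (Localization.AtPrime P)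
    (LocalizedModule P.primeCompl M)).toModuleIso

lemma annihilator_ext_le_iff_height_eq {S : Type u} [CommRing S] [IsRegularRing S]
    (M : Type u) [AddCommGroup M] [Module S M] [Module.Finite S M]
    (e : ℕ) (he : projectiveDimension (ModuleCat.of S M) = e) (P : Ideal S)
    (hP : P ∈ associatedPrimes S M) :
    Module.annihilator S (Abelian.Ext (ModuleCat.of S M) (ModuleCat.of S S) e) ≤ P ↔
      P.height = e := by
  have hprime : P.IsPrime := hP.isPrime
  have hle : HasProjectiveDimensionLE (ModuleCat.of S M) e :=
    (projectiveDimension_le_iff _ _).mp he.le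
  have hpd := projectiveDimension_localizedModule_eq_height M P hP
  have h1 := ModuleCat.projectiveDimension_le_projectiveDimension_of_isLocalizedModule
    P.primeCompl (ModuleCat.of S M)
  have h2 := exists_annihilator_ext_iff P.primeCompl e (ModuleCat.of S M)
  rw [← projectiveDimension_lt_iff, hpd, ← not_le] at h2
  rw [hpd, he] at h1
  -- Negating both sides turns this into the existence of an annihilating element outside `P`.
  have h3 : Module.annihilator S (Abelian.Ext (ModuleCat.of S M) (ModuleCat.of S S) e) ≤ P ↔
      (e : WithBot ℕ∞) ≤ P.height := by
    rw [← not_iff_not, ← h2, SetLike.not_le_iff_exists]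
    simp only [Module.mem_annihilator, Ideal.mem_primeCompl_iff]
    exact exists_congr fun _ => and_comm
  rw [h3]
  have h4 : (P.height : WithBot ℕ∞) = e ↔ P.height = e := by norm_cast
  rw [← h4]
  exact ⟨fun h => le_antisymm h1 h, fun h => h.ge⟩

/-- `he` already excludes `M = 0`, whose projective dimension is `⊥`. -/
theorem mainTheorem7 {S : Type u} [CommRing S] [IsRegularRing S]
    (M : Type u) [AddCommGroup M] [Module S M] [Module.Finite S M]
    (e : ℕ) (he : projectiveDimension (ModuleCat.of S M) = e)
    (I : Ideal S)
    (hI : I = Module.annihilator S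
      (Abelian.Ext (ModuleCat.of S M) (ModuleCat.of S S) e)) :
    (associatedPrimesOfCodim S M e).Nonempty ↔
      Nontrivial ((localCohomology I 0).obj (ModuleCat.of S M)) := by
  rw [nontrivial_localCohomology_zero_iff_associatedPrimes]
  subst hI
  exact exists_congr fun P => and_congr_right fun hP =>
    (annihilator_ext_le_iff_height_eq M e he P hP).symm
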